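/- Let $\xi$ and $\xi^*$ be integrable random vectors in $\mathbb{R}^d$, possibly defined on different probability spaces. They are called zonoid equivalent if $\mathbb{E}|\langle u,\xi\rangle|=\mathbb{E}|\langle u,\xi^*\rangle|$ for all $u\in\mathbb{R}^d$. Let $\mathcal{H}_e$ be the family of all even Borel measurable functions $f:\mathbb{R}^d\to[0,\infty)$ such that $f(cx)=cf(x)$ for all $x\in\mathbb{R}^d$ and all $c\ge 0$. Then $\xi$ and $\xi^*$ are zonoid equivalent if and only if $\mathbb{E}f(\xi)=\mathbb{E}f(\xi^*)$ for all $f\in\mathcal{H}_e$, where the expectations are taken in $[0,\infty]$ (so that one of them is finite if and only if the other is). -/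

import Mathlib

open MeasureTheory
open scoped NNReal ENNReal

/-- Random vectors `ξ`, `η` in `ℝ^d` (possibly on different probability spaces, and meant to be
integrable) are zonoid equivalent if `E|⟨u, ξ⟩| = E|⟨u, η⟩|` for every `u`, that is, if the
support functions of their centred zonoids coincide. -/
def ZonoidEquivalent {d : ℕ} {Ω Ω' : Type*} [MeasurableSpace Ω] [MeasurableSpace Ω']
    (P : Measure Ω) (P' : Measure Ω')
    (ξ : Ω → EuclideanSpace ℝ (Fin d)) (η : Ω' → EuclideanSpace ℝ (Fin d)) : Prop :=
  ∀ u : EuclideanSpace ℝ (Fin d),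
    ∫ ω, |inner ℝ u (ξ ω)| ∂P = ∫ ω, |inner ℝ u (η ω)| ∂P'

/-- The even Borel functions `f : ℝ^d → [0, ∞)` with `f (c x) = c f x` for all `x` and `c ≥ 0`. -/
def evenHomogeneousFunctions (d : ℕ) : Set (EuclideanSpace ℝ (Fin d) → ℝ≥0) :=
  {f | Measurable f ∧ (∀ (c : ℝ≥0) (x : EuclideanSpace ℝ (Fin d)), f ((c : ℝ) • x) = c * f x) ∧
    ∀ x, f (-x) = f x}

/-! Write `h u` for the integral of `|⟨x, u⟩|` over the law `μ`. For fixed `v`, the second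
difference `(h (u + v) + h (u - v)) / 2 - h u` is, up to a constant, the characteristic function of
the finite measure `radialMeasure μ v`; so `h` determines that measure (`charFun_radialMeasure`,
`radialMeasure_eq`). Summing over an orthonormal basis of `v` gives the density `cosWeight b (s • x)
/ s ^ 2`, whose numerator depends only on `y = s • x` and can be divided out. Testing against `f y *
‖y‖ / cosWeight b y` on the unit ball then leaves `2 * f x` after integration in `s`
(`sum_lintegral_radialTest`). The converse takes `f = |⟨u, ·⟩|`. -/

/-- The kernel of the representation `∫ (1 - cos (s a)) / s² ds = c |a|`. -/
noncomputable def cosKernel (a s : ℝ) : ℝ := (1 - Real.cos (s * a)) / s ^ 2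

lemma cosKernel_nonneg (a s : ℝ) : 0 ≤ cosKernel a s :=
  div_nonneg (by linarith [Real.cos_le_one (s * a)]) (sq_nonneg s)

lemma measurable_cosKernel : Measurable fun p : ℝ × ℝ ↦ cosKernel p.1 p.2 := by
  unfold cosKernel
  fun_prop

lemma cosKernel_one_le (s : ℝ) : cosKernel 1 s ≤ 4 * (1 + s ^ 2)⁻¹ := by
  rcases eq_or_ne s 0 with rfl | hs
  · simp [cosKernel]
  have hs2 : 0 < s ^ 2 := by positivity
  rw [cosKernel, mul_one, ← div_eq_mul_inv, div_le_div_iff₀ hs2 (by positivity)]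
  have h1 := Real.one_sub_sq_div_two_le_cos (x := s)
  have h2 := Real.neg_one_le_cos s
  nlinarith

lemma integrable_cosKernel_one : Integrable (cosKernel 1) := by
  refine (integrable_inv_one_add_sq.const_mul 4).mono'
    (measurable_cosKernel.comp measurable_prodMk_left).aestronglyMeasurable (.of_forall fun s ↦ ?_)
  rw [Real.norm_of_nonneg (cosKernel_nonneg 1 s)]
  exact cosKernel_one_le s

lemma cosKernel_eq (a s : ℝ) : cosKernel a s = a ^ 2 * cosKernel 1 (a * s) := by
  rcases eq_or_ne a 0 with rfl | ha
  · simp [cosKernel]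
  rcases eq_or_ne s 0 with rfl | hs
  · simp [cosKernel]
  unfold cosKernel
  rw [mul_one, mul_comm s a]
  field_simp

lemma integrable_cosKernel (a : ℝ) : Integrable (cosKernel a) := by
  rcases eq_or_ne a 0 with rfl | ha
  · simp [funext (cosKernel_eq 0)]
  · rw [funext (cosKernel_eq a)]
    exact (integrable_cosKernel_one.comp_mul_left' ha).const_mul _

lemma integral_cosKernel (a : ℝ) : ∫ s, cosKernel a s = (∫ s, cosKernel 1 s) * |a| := by
  rcases eq_or_ne a 0 with rfl | ha
  · simp [cosKernel]
  · simp_rw [cosKernel_eq a]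
    rw [integral_const_mul, Measure.integral_comp_mul_left, smul_eq_mul, ← sq_abs a, abs_inv]
    have := abs_pos.2 ha
    field_simp

/-- The product-to-sum formula turns modulation by `cos (s * a)` into a second difference of `|·|`
at `a` with step `b`. -/
lemma integral_cos_mul_cosKernel (a b : ℝ) :
    ∫ s, Real.cos (s * a) * cosKernel b s =
      (∫ s, cosKernel 1 s) * ((|a + b| + |a - b|) / 2 - |a|) := by
  have h : ∀ s, Real.cos (s * a) * cosKernel b s =
      (cosKernel (a + b) s + cosKernel (a - b) s) / 2 - cosKernel a s := fun s ↦ by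
    simp only [cosKernel, mul_add, mul_sub, Real.cos_add, Real.cos_sub]
    ring
  simp_rw [h]
  rw [integral_sub (((integrable_cosKernel _).fun_add (integrable_cosKernel _)).div_const 2)
    (integrable_cosKernel _), integral_div,
    integral_add (integrable_cosKernel _) (integrable_cosKernel _)]
  simp_rw [integral_cosKernel (a + b), integral_cosKernel (a - b), integral_cosKernel a]
  ring

/-- The integrand is odd in `s`. -/
lemma integral_sin_mul_cosKernel (a b : ℝ) :
    ∫ s, Real.sin (s * a) * cosKernel b s = 0 := by
  have h := integral_neg_eq_self (fun s ↦ Real.sin (s * a) * cosKernel b s) volume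
  simp only [cosKernel, neg_mul, Real.sin_neg, Real.cos_neg, neg_sq, integral_neg] at h ⊢
  linarith

lemma integral_cexp_mul_cosKernel (a b : ℝ) :
    ∫ s : ℝ, Complex.exp ((s * a : ℝ) * Complex.I) * (cosKernel b s : ℂ) =
      (((∫ s, cosKernel 1 s) * ((|a + b| + |a - b|) / 2 - |a|) : ℝ) : ℂ) := by
  have hc : Integrable fun s : ℝ ↦ Real.cos (s * a) * cosKernel b s :=
    (integrable_cosKernel b).bdd_mul (c := 1) (by fun_prop)
      (.of_forall fun s ↦ Real.abs_cos_le_one _)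
  have hs : Integrable fun s : ℝ ↦ Real.sin (s * a) * cosKernel b s :=
    (integrable_cosKernel b).bdd_mul (c := 1) (by fun_prop)
      (.of_forall fun s ↦ Real.abs_sin_le_one _)
  have h : ∀ s : ℝ, Complex.exp ((s * a : ℝ) * Complex.I) * (cosKernel b s : ℂ) =
      ((Real.cos (s * a) * cosKernel b s : ℝ) : ℂ) +
        ((Real.sin (s * a) * cosKernel b s : ℝ) : ℂ) * Complex.I := fun s ↦ by
    rw [Complex.exp_mul_I]
    push_cast
    ring
  simp_rw [h]
  rw [integral_add hc.ofReal (hs.ofReal.mul_const _), integral_mul_const, integral_complex_ofReal,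
    integral_complex_ofReal, integral_cos_mul_cosKernel, integral_sin_mul_cosKernel]
  simp

/-! ### Weight and test function on the unit ball -/

section CosWeight

variable {E : Type*} [NormedAddCommGroup E] [InnerProductSpace ℝ E]

/-- The sum of the functions `1 - cos ⟨y, e⟩` over an orthonormal basis. -/
noncomputable def cosWeight {ι : Type*} [Fintype ι] (b : OrthonormalBasis ι ℝ E) (y : E) : ℝ≥0∞ :=
  ∑ i, ENNReal.ofReal (1 - Real.cos (inner ℝ y (b i)))

lemma cosWeight_ne_top {ι : Type*} [Fintype ι] (b : OrthonormalBasis ι ℝ E) (y : E) :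
    cosWeight b y ≠ ∞ :=
  ENNReal.sum_ne_top.2 fun _ _ ↦ ENNReal.ofReal_ne_top

/-- In the unit ball every coordinate lies in `(-2π, 2π)`, where the cosine equals 1 only at 0. -/
lemma cosWeight_ne_zero {ι : Type*} [Fintype ι] (b : OrthonormalBasis ι ℝ E) {y : E}
    (hy : y ≠ 0) (hy1 : ‖y‖ ≤ 1) : cosWeight b y ≠ 0 := by
  contrapose! hy
  refine InnerProductSpace.ext_inner_right_basis b.toBasis fun i ↦ ?_
  have h := (Finset.sum_eq_zero_iff.1 hy) i (Finset.mem_univ i)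
  have hle : |inner ℝ y (b i)| ≤ 1 := (abs_real_inner_le_norm _ _).trans (by simpa using hy1)
  have hpi := Real.pi_gt_three
  rw [abs_le] at hle
  rw [ENNReal.ofReal_eq_zero] at h
  have := (Real.cos_eq_one_iff_of_lt_of_lt (by linarith) (by linarith)).1
    (le_antisymm (Real.cos_le_one (inner ℝ y (b i))) (by linarith))
  simpa using this

/-- The function whose integrals against the radial measures of `μ` recover `∫ f dμ`. -/
noncomputable def radialTest {ι : Type*} [Fintype ι] (b : OrthonormalBasis ι ℝ E) (f : E → ℝ≥0)
    (y : E) : ℝ≥0∞ :=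
  (Metric.closedBall (0 : E) 1).indicator (fun y ↦ f y * ‖y‖ₑ * (cosWeight b y)⁻¹) y

/-- The factors `|s|` from `f` and from the norm cancel `s⁻²`, so the integrand is constant in `s`
while `s • x` stays in the ball. -/
lemma radialTest_smul {ι : Type*} [Fintype ι] (b : OrthonormalBasis ι ℝ E) {f : E → ℝ≥0}
    (hhom : ∀ (c : ℝ≥0) (x : E), f ((c : ℝ) • x) = c * f x) (heven : ∀ x, f (-x) = f x)
    {x : E} (hx : x ≠ 0) {s : ℝ} (hs : s ≠ 0) :
    ENNReal.ofReal ((s ^ 2)⁻¹) * (cosWeight b (s • x) * radialTest b f (s • x)) =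
      (Set.Icc (-‖x‖⁻¹) ‖x‖⁻¹).indicator (fun _ ↦ f x * ‖x‖ₑ) s := by
  have hx0 : 0 < ‖x‖ := norm_pos_iff.2 hx
  have hmem : s • x ∈ Metric.closedBall (0 : E) 1 ↔ s ∈ Set.Icc (-‖x‖⁻¹) ‖x‖⁻¹ := by
    rw [mem_closedBall_zero_iff, norm_smul, Real.norm_eq_abs, ← le_div_iff₀ hx0, one_div, abs_le,
      Set.mem_Icc]
  by_cases h : s ∈ Set.Icc (-‖x‖⁻¹) ‖x‖⁻¹
  · have hb := hmem.2 h
    rw [radialTest, Set.indicator_of_mem hb, Set.indicator_of_mem h]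
    have hW := cosWeight_ne_zero b (smul_ne_zero hs hx) (mem_closedBall_zero_iff.1 hb)
    have hfs : f (s • x) = ‖s‖₊ * f x := by
      rw [← hhom, coe_nnnorm, Real.norm_eq_abs]
      rcases abs_choice s with h | h <;> rw [h]
      rw [neg_smul, heven]
    have hs' : ENNReal.ofReal ((s ^ 2)⁻¹) * (‖s‖ₑ * ‖s‖ₑ) = 1 := by
      rw [← ofReal_norm, ← ENNReal.ofReal_mul (norm_nonneg s), ← ENNReal.ofReal_mul (by positivity),
        Real.norm_eq_abs, abs_mul_abs_self, ← sq, inv_mul_cancel₀ (by positivity),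
        ENNReal.ofReal_one]
    rw [hfs, enorm_smul, ENNReal.coe_mul]
    change _ * (_ * (‖s‖ₑ * _ * _ * _)) = _
    calc _ = (ENNReal.ofReal ((s ^ 2)⁻¹) * (‖s‖ₑ * ‖s‖ₑ)) *
          (cosWeight b (s • x) * (cosWeight b (s • x))⁻¹) * (f x * ‖x‖ₑ) := by ring
      _ = _ := by
        rw [hs', ENNReal.mul_inv_cancel hW (cosWeight_ne_top b _), one_mul, one_mul]
  · rw [radialTest, Set.indicator_of_notMem (mt hmem.1 h), Set.indicator_of_notMem h, mul_zero,
      mul_zero]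

end CosWeight

/-! ### Radial measures and their characteristic functions -/

section RadialMeasure

variable {E : Type*} [NormedAddCommGroup E] [InnerProductSpace ℝ E] [FiniteDimensional ℝ E]
  [MeasurableSpace E] [BorelSpace E]

/-- The image of `(1 - cos (s ⟨x, v⟩)) / s² ds ⊗ μ(dx)` under `(s, x) ↦ s x`. -/
noncomputable def radialMeasure (μ : Measure E) (v : E) : Measure E :=
  (((volume : Measure ℝ).prod μ).withDensity
    fun p ↦ ENNReal.ofReal (cosKernel (inner ℝ p.2 v) p.1)).map fun p ↦ p.1 • p.2

lemma measurable_cosKernel_inner (v : E) :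
    Measurable fun p : ℝ × E ↦ cosKernel (inner ℝ p.2 v) p.1 := by
  unfold cosKernel
  fun_prop

lemma lintegral_radialMeasure (μ : Measure E) [SFinite μ] (v : E) {F : E → ℝ≥0∞}
    (hF : Measurable F) :
    ∫⁻ y, F y ∂radialMeasure μ v =
      ∫⁻ x, ∫⁻ s : ℝ, ENNReal.ofReal (cosKernel (inner ℝ x v) s) * F (s • x) ∂volume ∂μ := by
  have hk := (measurable_cosKernel_inner v).ennreal_ofReal
  have hF' : Measurable fun p : ℝ × E ↦ F (p.1 • p.2) := hF.comp (by fun_prop)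
  rw [radialMeasure, lintegral_map hF (by fun_prop), lintegral_withDensity_eq_lintegral_mul _ hk hF',
    lintegral_prod_symm _ (hk.mul hF').aemeasurable]
  rfl

lemma isFiniteMeasure_radialMeasure {μ : Measure E} [SFinite μ] (hμ : Integrable id μ) (v : E) :
    IsFiniteMeasure (radialMeasure μ v) := by
  refine ⟨?_⟩
  rw [← lintegral_one, lintegral_radialMeasure μ v measurable_const]
  simp_rw [mul_one, ← ofReal_integral_eq_lintegral_ofReal (integrable_cosKernel _)
    (.of_forall (cosKernel_nonneg _)), integral_cosKernel (inner ℝ _ v)]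
  exact ((hμ.inner_const v).abs.const_mul _).lintegral_lt_top

lemma charFun_radialMeasure {μ : Measure E} [SFinite μ] (hμ : Integrable id μ) (v u : E) :
    charFun (radialMeasure μ v) u =
      (((∫ s, cosKernel 1 s) * ((∫ x, |inner ℝ x (u + v)| ∂μ + ∫ x, |inner ℝ x (u - v)| ∂μ) / 2 -
        ∫ x, |inner ℝ x u| ∂μ) : ℝ) : ℂ) := by
  have hk := measurable_cosKernel_inner v
  have hint : Integrable (fun p : ℝ × E ↦ cosKernel (inner ℝ p.2 v) p.1) (volume.prod μ) := by
    refine ⟨hk.aestronglyMeasurable, ?_⟩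
    -- The total mass of the radial measure is the integral of the kernel over the product, so
    -- finiteness gives the integrability needed for Fubini.
    have := isFiniteMeasure_radialMeasure hμ v
    have h := measure_lt_top (radialMeasure μ v) Set.univ
    rw [← lintegral_one, radialMeasure, lintegral_map measurable_const (by fun_prop),
      lintegral_one, withDensity_apply _ .univ, setLIntegral_univ] at h
    rw [hasFiniteIntegral_iff_ofReal (.of_forall fun p ↦ cosKernel_nonneg _ _)]
    exact h
  have hexp : Integrable (fun p : ℝ × E ↦ Complex.exp ((p.1 * inner ℝ p.2 u : ℝ) * Complex.I) *
      (cosKernel (inner ℝ p.2 v) p.1 : ℂ)) (volume.prod μ) :=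
    hint.ofReal.bdd_mul (c := 1) (by fun_prop)
      (.of_forall fun p ↦ (Complex.norm_exp_ofReal_mul_I _).le)
  have hi : ∀ w : E, Integrable (fun x ↦ |inner ℝ x w|) μ := fun w ↦ (hμ.inner_const w).abs
  rw [charFun_apply, radialMeasure, integral_map (by fun_prop) (by fun_prop),
    integral_withDensity_eq_integral_toReal_smul hk.ennreal_ofReal
      (.of_forall fun p ↦ ENNReal.ofReal_lt_top)]
  have h : ∀ p : ℝ × E, (ENNReal.ofReal (cosKernel (inner ℝ p.2 v) p.1)).toReal •
      Complex.exp ((inner ℝ (p.1 • p.2) u : ℝ) * Complex.I) =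
      Complex.exp ((p.1 * inner ℝ p.2 u : ℝ) * Complex.I) *
        (cosKernel (inner ℝ p.2 v) p.1 : ℂ) := fun p ↦ by
    rw [ENNReal.toReal_ofReal (cosKernel_nonneg _ _), Complex.real_smul, real_inner_smul_left,
      mul_comm]
  simp_rw [h]
  rw [integral_prod_symm _ hexp]
  simp_rw [integral_cexp_mul_cosKernel]
  rw [integral_complex_ofReal, integral_const_mul]
  simp_rw [← inner_add_right, ← inner_sub_right]
  rw [integral_sub (((hi _).fun_add (hi _)).div_const 2) (hi _), integral_div,
    integral_add (hi _) (hi _)]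

lemma radialMeasure_eq {μ ν : Measure E} [SFinite μ] [SFinite ν] (hμ : Integrable id μ)
    (hν : Integrable id ν) (h : ∀ u : E, ∫ x, |inner ℝ x u| ∂μ = ∫ x, |inner ℝ x u| ∂ν) (v : E) :
    radialMeasure μ v = radialMeasure ν v := by
  have := isFiniteMeasure_radialMeasure hμ v
  have := isFiniteMeasure_radialMeasure hν v
  refine Measure.ext_of_charFun (funext fun u ↦ ?_)
  rw [charFun_radialMeasure hμ, charFun_radialMeasure hν, h, h, h]

lemma measurable_cosWeight {ι : Type*} [Fintype ι] (b : OrthonormalBasis ι ℝ E) :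
    Measurable (cosWeight b) := by
  unfold cosWeight
  fun_prop

lemma lintegral_radialMeasure_sum {ι : Type*} [Fintype ι] (b : OrthonormalBasis ι ℝ E)
    (μ : Measure E) [SFinite μ] {F : E → ℝ≥0∞} (hF : Measurable F) :
    ∑ i, ∫⁻ y, F y ∂radialMeasure μ (b i) =
      ∫⁻ x, ∫⁻ s : ℝ, ENNReal.ofReal ((s ^ 2)⁻¹) * (cosWeight b (s • x) * F (s • x)) ∂volume ∂μ := by
  have hm (i : ι) : Measurable fun p : E × ℝ ↦
      ENNReal.ofReal (cosKernel (inner ℝ p.1 (b i)) p.2) * F (p.2 • p.1) := by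
    unfold cosKernel
    fun_prop
  simp_rw [lintegral_radialMeasure μ _ hF]
  rw [← lintegral_finsetSum _ fun i _ ↦ (hm i).lintegral_prod_right']
  refine lintegral_congr fun x ↦ ?_
  have hx (i : ι) : Measurable fun s : ℝ ↦
      ENNReal.ofReal (cosKernel (inner ℝ x (b i)) s) * F (s • x) := by
    unfold cosKernel
    fun_prop
  rw [← lintegral_finsetSum _ fun i _ ↦ hx i]
  refine lintegral_congr fun s ↦ ?_
  rw [← Finset.sum_mul, cosWeight, ← mul_assoc, Finset.mul_sum]
  congr 1
  refine Finset.sum_congr rfl fun i _ ↦ ?_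
  rw [cosKernel, real_inner_smul_left, ← ENNReal.ofReal_mul (by positivity), div_eq_inv_mul]

lemma measurable_radialTest {ι : Type*} [Fintype ι] (b : OrthonormalBasis ι ℝ E) {f : E → ℝ≥0}
    (hf : Measurable f) : Measurable (radialTest b f) :=
  ((hf.coe_nnreal_ennreal.mul measurable_enorm).mul (measurable_cosWeight b).inv).indicator
    Metric.isClosed_closedBall.measurableSet

lemma sum_lintegral_radialTest {ι : Type*} [Fintype ι] (b : OrthonormalBasis ι ℝ E)
    (μ : Measure E) [SFinite μ] {f : E → ℝ≥0} (hf : Measurable f)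
    (hhom : ∀ (c : ℝ≥0) (x : E), f ((c : ℝ) • x) = c * f x) (heven : ∀ x, f (-x) = f x) :
    ∑ i, ∫⁻ y, radialTest b f y ∂radialMeasure μ (b i) = 2 * ∫⁻ x, f x ∂μ := by
  rw [lintegral_radialMeasure_sum b μ (measurable_radialTest b hf),
    ← lintegral_const_mul _ hf.coe_nnreal_ennreal]
  refine lintegral_congr fun x ↦ ?_
  rcases eq_or_ne x 0 with rfl | hx
  · have h0 : f 0 = 0 := by simpa using hhom 0 0
    simp [radialTest, h0]
  have hne : ∀ᵐ s : ℝ, s ≠ 0 := Measure.ae_ne volume 0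
  rw [lintegral_congr_ae (hne.mono fun s hs ↦ radialTest_smul b hhom heven hx hs),
    lintegral_indicator measurableSet_Icc, setLIntegral_const, Real.volume_Icc]
  have hx0 : 0 < ‖x‖ := norm_pos_iff.2 hx
  -- The interval of admissible `s` has length `2 / ‖x‖`, cancelling the factor `‖x‖`.
  rw [mul_assoc, ← ofReal_norm, ← ENNReal.ofReal_mul hx0.le, mul_comm]
  congr 1
  rw [show ‖x‖ * (‖x‖⁻¹ - -‖x‖⁻¹) = 2 by field_simp; norm_num]
  simp

/-- The cosine transform of an integrable measure determines the integrals of all even,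
positively homogeneous functions. -/
theorem lintegral_eq_of_integral_abs_inner_eq {μ ν : Measure E} [SFinite μ] [SFinite ν]
    (hμ : Integrable id μ) (hν : Integrable id ν)
    (h : ∀ u : E, ∫ x, |inner ℝ x u| ∂μ = ∫ x, |inner ℝ x u| ∂ν) {f : E → ℝ≥0} (hf : Measurable f)
    (hhom : ∀ (c : ℝ≥0) (x : E), f ((c : ℝ) • x) = c * f x) (heven : ∀ x, f (-x) = f x) :
    ∫⁻ x, f x ∂μ = ∫⁻ x, f x ∂ν := by
  have hb := sum_lintegral_radialTest (stdOrthonormalBasis ℝ E) μ hf hhom heven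
  simp_rw [radialMeasure_eq hμ hν h] at hb
  rw [sum_lintegral_radialTest _ ν hf hhom heven] at hb
  exact ((ENNReal.mul_right_inj two_ne_zero ENNReal.ofNat_ne_top).1 hb).symm

end RadialMeasure

theorem mainTheorem5 {d : ℕ} {Ω Ω' : Type*} [MeasurableSpace Ω] [MeasurableSpace Ω']
    (P : Measure Ω) [IsProbabilityMeasure P] (P' : Measure Ω') [IsProbabilityMeasure P']
    (ξ : Ω → EuclideanSpace ℝ (Fin d)) (η : Ω' → EuclideanSpace ℝ (Fin d))
    (hξ : Integrable ξ P) (hη : Integrable η P') :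
    ZonoidEquivalent P P' ξ η ↔
      ∀ f ∈ evenHomogeneousFunctions d,
        ∫⁻ ω, (f (ξ ω) : ℝ≥0∞) ∂P = ∫⁻ ω, (f (η ω) : ℝ≥0∞) ∂P' := by
  constructor
  · rintro h f ⟨hf, hhom, heven⟩
    have hμ : Integrable id (P.map ξ) :=
      (integrable_map_measure aestronglyMeasurable_id hξ.aemeasurable).2 hξ
    have hν : Integrable id (P'.map η) :=
      (integrable_map_measure aestronglyMeasurable_id hη.aemeasurable).2 hη
    have := lintegral_eq_of_integral_abs_inner_eq hμ hν (fun u ↦ by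
      rw [integral_map hξ.aemeasurable (by fun_prop), integral_map hη.aemeasurable (by fun_prop)]
      simpa only [real_inner_comm] using h u) hf hhom heven
    rwa [lintegral_map' hf.coe_nnreal_ennreal.aemeasurable hξ.aemeasurable,
      lintegral_map' hf.coe_nnreal_ennreal.aemeasurable hη.aemeasurable] at this
  · intro h u
    have hu := h (fun x ↦ ‖inner ℝ u x‖₊) ⟨by fun_prop, fun c x ↦ by
      beta_reduce
      rw [real_inner_smul_right, nnnorm_mul]
      simp, fun x ↦ by simp only [inner_neg_right, nnnorm_neg]⟩
    simp_rw [← Real.norm_eq_abs]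
    rw [integral_norm_eq_lintegral_enorm (hξ.const_inner u).aestronglyMeasurable,
      integral_norm_eq_lintegral_enorm (hη.const_inner u).aestronglyMeasurable]
    exact congrArg ENNReal.toReal hu
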